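/- Let $f:\mathbb{R}^n\to\mathbb{R}$ be continuously differentiable and nonnegative, with $\|\nabla f(x)-\nabla f(y)\|\le L\|x-y\|$ for all $x,y\in\mathbb{R}^n$ and some constant $L$. Let $(\Omega,\mathcal{F},P)$ be a probability space with a filtration $(\mathcal{F}_t)_{t\ge 0}$, and let $(r_t)_{t\ge0}$, $(s_t)_{t\ge0}$, $(w_t)_{t\ge0}$ be sequences of $\mathbb{R}^n$-valued random variables such that $r_t$ is $\mathcal{F}_t$-measurable, $s_t$ is integrable, and $$r_{t+1}=r_t+\gamma_t(s_t+w_t)\qquad\text{almost surely, for all } t\ge 0,$$ where the (deterministic) stepsizes $\gamma_t\ge 0$ satisfy $\sum_{t=0}^\infty\gamma_t=\infty$ and $\sum_{t=0}^\infty\gamma_t^2<\infty$. Suppose that there are positive constants $c_1,c_2,p,q$ such that for every $t\ge0$, almost surely, $$c_1\|\nabla f(r_t)\|^2\le-\nabla f(r_t)^{T}\,\mathbb{E}[s_t\mid\mathcal{F}_t],\qquad \mathbb{E}[\|s_t\|^2\mid\mathcal{F}_t]\le c_2\|\nabla f(r_t)\|^2,$$ $$\mathbb{E}[\|w_t\|^2\mid\mathcal{F}_t]\le\big(\gamma_t\,(q+p\|\nabla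 f(r_t)\|)\big)^2,$$ where the conditional expectations of the nonnegative variables $\|s_t\|^2$, $\|w_t\|^2$ are taken in $[0,\infty]$. Then, with probability $1$: (a) the sequence $f(r_t)$ converges to a finite limit; (b) $\lim_{t\to\infty}\nabla f(r_t)=0$; (c) every limit point of the sequence $(r_t)$ is a stationary point of $f$. -/

import Mathlib

open Filter Topology MeasureTheory ProbabilityTheory
open scoped ENNReal NNReal

/-! Robbins–Siegmund is applied twice. For `f (r t)`, the descent condition yields a drift of `-c₁ γ
‖∇f‖²` up to errors of order `γ² (1 + ‖∇f‖²)`. Since `‖∇f‖² ≤ 4 K f` for a nonnegative function with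
`K`-Lipschitz gradient, these errors are a summable multiple of `f` plus a summable constant. Hence
`f (r t)` converges and `∑ γ ‖∇f‖² < ∞`.

For `‖∇f (r t)‖²`, Lipschitz continuity bounds the expected increase by a multiple of `γ ‖∇f‖²`,
summable by the first application, plus terms of order `γ²`. So `‖∇f (r t)‖²` itself converges, and
`∑ γ = ∞` forces the limit to be `0`; no upcrossing argument for the gradient is needed.

Nothing makes `f (r 0)` integrable, so drift inequalities are stated as lower integrals over sets of
the past and proved on sets where the current iterate is controlled. -/

/-! ### Almost supermartingales -/

/-- Taking the whole space in `hstep` propagates integrability from time `0`, so `Y` is an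
L¹-bounded supermartingale and Doob's theorem applies to `-Y`. -/
theorem ae_tendsto_of_setLIntegral_succ_le {Ω : Type*} {mΩ : MeasurableSpace Ω} {μ : Measure Ω}
    [IsFiniteMeasure μ] {ℱ : Filtration ℕ mΩ} {Y : ℕ → Ω → ℝ} (hY : StronglyAdapted ℱ Y)
    (hnn : ∀ t ω, 0 ≤ Y t ω) (h0 : ∫⁻ ω, ENNReal.ofReal (Y 0 ω) ∂μ ≠ ∞)
    (hstep : ∀ t, ∀ A, MeasurableSet[ℱ t] A →
      ∫⁻ ω in A, ENNReal.ofReal (Y (t + 1) ω) ∂μ ≤ ∫⁻ ω in A, ENNReal.ofReal (Y t ω) ∂μ) :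
    ∀ᵐ ω ∂μ, ∃ l, Tendsto (fun t => Y t ω) atTop (𝓝 l) := by
  have hle : ∀ t, ∫⁻ ω, ENNReal.ofReal (Y t ω) ∂μ ≤ ∫⁻ ω, ENNReal.ofReal (Y 0 ω) ∂μ := by
    intro t
    induction t with
    | zero => exact le_rfl
    | succ t ih =>
      have := hstep t Set.univ MeasurableSet.univ
      rw [setLIntegral_univ, setLIntegral_univ] at this
      exact this.trans ih
  have hm : ∀ t, AEStronglyMeasurable (Y t) μ := fun t =>
    ((hY t).mono (ℱ.le t)).aestronglyMeasurable
  have hint : ∀ t, Integrable (Y t) μ := fun t =>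
    (lintegral_ofReal_ne_top_iff_integrable (hm t) (ae_of_all _ (hnn t))).1
      (ne_top_of_le_ne_top h0 (hle t))
  have hsup : Supermartingale Y ℱ μ := by
    refine supermartingale_of_setIntegral_succ_le hY hint fun t A hA => ?_
    rw [integral_eq_lintegral_of_nonneg_ae (ae_of_all _ (hnn _)) (hm _).restrict,
      integral_eq_lintegral_of_nonneg_ae (ae_of_all _ (hnn _)) (hm _).restrict]
    refine ENNReal.toReal_mono ?_ (hstep t A hA)
    exact ne_top_of_le_ne_top h0 ((setLIntegral_le_lintegral _ _).trans (hle t))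
  have hbdd : ∀ t, eLpNorm ((-Y) t) 1 μ
      ≤ ((∫⁻ ω, ENNReal.ofReal (Y 0 ω) ∂μ).toNNReal : ℝ≥0∞) := by
    intro t
    rw [ENNReal.coe_toNNReal h0, Pi.neg_apply, eLpNorm_neg, eLpNorm_one_eq_lintegral_enorm]
    refine le_trans (le_of_eq (lintegral_congr fun ω => ?_)) (hle t)
    rw [Real.enorm_eq_ofReal (hnn t ω)]
  filter_upwards [hsup.neg.ae_tendsto_limitProcess hbdd] with ω hω
  exact ⟨_, by simpa using hω.neg⟩

/-- The **Robbins–Siegmund theorem** without multiplicative perturbation, where the conditional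
drift inequality is stated through integrals over sets of the past. -/
theorem ae_tendsto_and_summable_of_setLIntegral_le {Ω : Type*} {mΩ : MeasurableSpace Ω}
    {μ : Measure Ω} [IsFiniteMeasure μ] {ℱ : Filtration ℕ mΩ} {V b c : ℕ → Ω → ℝ}
    (hV : StronglyAdapted ℱ V) (hb : StronglyAdapted ℱ b) (hc : StronglyAdapted ℱ c)
    (hV0 : ∀ t ω, 0 ≤ V t ω) (hb0 : ∀ t ω, 0 ≤ b t ω) (hc0 : ∀ t ω, 0 ≤ c t ω)
    (hstep : ∀ t, ∀ A, MeasurableSet[ℱ t] A →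
      ∫⁻ ω in A, ENNReal.ofReal (V (t + 1) ω) + ENNReal.ofReal (c t ω) ∂μ
        ≤ ∫⁻ ω in A, ENNReal.ofReal (V t ω + b t ω) ∂μ)
    (hbs : ∀ᵐ ω ∂μ, Summable fun t => b t ω) :
    ∀ᵐ ω ∂μ, (∃ l, Tendsto (fun t => V t ω) atTop (𝓝 l)) ∧ Summable fun t => c t ω := by
  have hsum : ∀ {u : ℕ → Ω → ℝ}, StronglyAdapted ℱ u → ∀ {t s}, t ≤ s + 1 →
      Measurable[ℱ s] fun ω => ∑ i ∈ Finset.range t, u i ω := by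
    intro u hu t s hts
    refine Finset.measurable_fun_sum _ fun i hi => ?_
    exact ((hu i).mono (ℱ.mono (by have := Finset.mem_range.1 hi; omega))).measurable
  have key : ∀ K : ℕ, ∀ᵐ ω ∂μ, V 0 ω ≤ K → (∀ t, ∑ i ∈ Finset.range t, b i ω ≤ K) →
      ∃ l, Tendsto (fun t => V t ω + ∑ i ∈ Finset.range t, c i ω
        + (K - ∑ i ∈ Finset.range t, b i ω)) atTop (𝓝 l) := by
    intro K
    -- Localization: `V 0 ≤ K` supplies integrability, and the budget `K` for the `b i` keeps `Z`
    -- nonnegative. The sum stops before `t`, so `E (t + 1)` already belongs to `ℱ t`; killing `Z`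
    -- off these decreasing sets preserves the supermartingale property.
    set E : ℕ → Set Ω := fun t => {ω | V 0 ω ≤ K} ∩ {ω | ∑ i ∈ Finset.range t, b i ω ≤ K} with hE
    have hEm : ∀ {t s}, t ≤ s + 1 → MeasurableSet[ℱ s] (E t) := fun {t s} hts =>
      MeasurableSet.inter
        (measurableSet_le ((hV 0).mono (ℱ.mono (Nat.zero_le _))).measurable measurable_const)
        (measurableSet_le (hsum hb hts) measurable_const)
    have hEanti : ∀ t, E (t + 1) ⊆ E t := by
      rintro t ω ⟨h1, h2⟩
      refine ⟨h1, ?_⟩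
      simp only [Set.mem_ofPred_eq, Finset.sum_range_succ] at h2 ⊢
      linarith [hb0 t ω]
    set Z : ℕ → Ω → ℝ := fun t ω => V t ω + ∑ i ∈ Finset.range t, c i ω
        + (K - ∑ i ∈ Finset.range t, b i ω) with hZ
    have hZm : ∀ t, Measurable[ℱ t] (Z t) := fun t =>
      ((hV t).measurable.add (hsum hc (Nat.le_succ t))).add
        (measurable_const.sub (hsum hb (Nat.le_succ t)))
    have hcs0 : ∀ t ω, 0 ≤ ∑ i ∈ Finset.range t, c i ω := fun t ω =>
      Finset.sum_nonneg fun i _ => hc0 i ω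
    have hlim : ∀ᵐ ω ∂μ, ∃ l, Tendsto (fun t => (E t).indicator (Z t) ω) atTop (𝓝 l) := by
      refine ae_tendsto_of_setLIntegral_succ_le (ℱ := ℱ) (fun t => ?_) (fun t ω => ?_) ?_ ?_
      · exact ((hZm t).indicator (hEm (Nat.le_succ t))).stronglyMeasurable
      · refine Set.indicator_nonneg (fun ω hω => ?_) ω
        have h2 : ∑ i ∈ Finset.range t, b i ω ≤ K := hω.2
        have := hV0 t ω
        have := hcs0 t ω
        simp only [hZ]
        linarith
      · refine ne_top_of_le_ne_top (b := ∫⁻ _, ENNReal.ofReal (K + K) ∂μ) ?_ ?_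
        · rw [lintegral_const]
          exact ENNReal.mul_ne_top ENNReal.ofReal_ne_top (measure_ne_top _ _)
        · refine lintegral_mono fun ω => ENNReal.ofReal_le_ofReal ?_
          by_cases hω : ω ∈ E 0
          · have h1 : V 0 ω ≤ K := hω.1
            simpa [hω, hZ] using h1
          · rw [Set.indicator_of_notMem hω]
            positivity
      · intro t A hA
        have hind : ∀ s B, MeasurableSet B → ∫⁻ ω in B, ENNReal.ofReal ((E s).indicator (Z s) ω) ∂μ
            = ∫⁻ ω in E s ∩ B, ENNReal.ofReal (Z s ω) ∂μ := by
          intro s B hB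
          have hEs : MeasurableSet (E s) := ℱ.le s _ (hEm (Nat.le_succ s))
          rw [← Measure.restrict_restrict hEs, ← lintegral_indicator hEs]
          refine lintegral_congr fun ω => ?_
          by_cases h : ω ∈ E s <;> simp [h]
        rw [hind _ A (ℱ.le t _ hA), hind _ A (ℱ.le t _ hA)]
        have hB : MeasurableSet[ℱ t] (E (t + 1) ∩ A) := (hEm le_rfl).inter hA
        refine le_trans ?_ (lintegral_mono_set (Set.inter_subset_inter_left A (hEanti t)))
        -- The part common to `Z t` and `Z (t + 1)`: nonnegative on `E (t + 1)`, it can be split off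
        -- both integrals, leaving exactly `hstep`.
        set R : Ω → ℝ := fun ω => ∑ i ∈ Finset.range t, c i ω
          + (K - ∑ i ∈ Finset.range (t + 1), b i ω) with hR
        have hRm : Measurable R := ((hsum hc (Nat.le_succ t)).add
          (measurable_const.sub (hsum hb le_rfl))).mono (ℱ.le t) le_rfl
        have hR0 : ∀ ω ∈ E (t + 1) ∩ A, 0 ≤ R ω := by
          rintro ω ⟨⟨-, h2⟩, -⟩
          have h2 : ∑ i ∈ Finset.range (t + 1), b i ω ≤ K := h2
          have := hcs0 t ω
          simp only [hR]
          linarith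
        calc ∫⁻ ω in E (t + 1) ∩ A, ENNReal.ofReal (Z (t + 1) ω) ∂μ
            = ∫⁻ ω in E (t + 1) ∩ A, (ENNReal.ofReal (V (t + 1) ω) + ENNReal.ofReal (c t ω))
                + ENNReal.ofReal (R ω) ∂μ := by
              refine setLIntegral_congr_fun (ℱ.le t _ hB) fun ω hω => ?_
              rw [← ENNReal.ofReal_add (hV0 _ _) (hc0 _ _),
                ← ENNReal.ofReal_add (add_nonneg (hV0 _ _) (hc0 _ _)) (hR0 ω hω)]
              congr 1
              simp only [hZ, hR, Finset.sum_range_succ]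
              ring
          _ = ∫⁻ ω in E (t + 1) ∩ A, ENNReal.ofReal (V (t + 1) ω) + ENNReal.ofReal (c t ω) ∂μ
                + ∫⁻ ω in E (t + 1) ∩ A, ENNReal.ofReal (R ω) ∂μ :=
              lintegral_add_right _ hRm.ennreal_ofReal
          _ ≤ ∫⁻ ω in E (t + 1) ∩ A, ENNReal.ofReal (V t ω + b t ω) ∂μ
                + ∫⁻ ω in E (t + 1) ∩ A, ENNReal.ofReal (R ω) ∂μ := by
              gcongr ?_ + _
              exact hstep t _ hB
          _ = ∫⁻ ω in E (t + 1) ∩ A, ENNReal.ofReal (V t ω + b t ω) + ENNReal.ofReal (R ω) ∂μ :=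
              (lintegral_add_right _ hRm.ennreal_ofReal).symm
          _ = ∫⁻ ω in E (t + 1) ∩ A, ENNReal.ofReal (Z t ω) ∂μ := by
              refine setLIntegral_congr_fun (ℱ.le t _ hB) fun ω hω => ?_
              rw [← ENNReal.ofReal_add (add_nonneg (hV0 _ _) (hb0 _ _)) (hR0 ω hω)]
              congr 1
              simp only [hZ, hR, Finset.sum_range_succ]
              ring
    filter_upwards [hlim] with ω ⟨l, hl⟩ h1 h2
    refine ⟨l, hl.congr fun t => ?_⟩
    exact Set.indicator_of_mem (show ω ∈ E t from ⟨h1, h2 t⟩) _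
  -- Almost every `ω` satisfies the localization bounds for some integer `K`.
  filter_upwards [ae_all_iff.2 key, hbs] with ω hω hbω
  obtain ⟨K, hK⟩ := exists_nat_ge (max (V 0 ω) (∑' t, b t ω))
  obtain ⟨l, hl⟩ := hω K ((le_max_left _ _).trans hK) fun t =>
    (hbω.sum_le_tsum _ fun i _ => hb0 i ω).trans ((le_max_right _ _).trans hK)
  have hbt := hbω.hasSum.tendsto_sum_nat
  have hVc : Tendsto (fun t => V t ω + ∑ i ∈ Finset.range t, c i ω) atTop
      (𝓝 (l - (K - ∑' t, b t ω))) := by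
    refine (hl.sub (tendsto_const_nhds.sub hbt)).congr fun t => ?_
    ring
  obtain ⟨M, hM⟩ := hVc.bddAbove_range
  have hcs : Summable fun t => c t ω := by
    refine summable_of_sum_range_le (c := M) (fun t => hc0 t ω) fun t => ?_
    have : V t ω + ∑ i ∈ Finset.range t, c i ω ≤ M := hM ⟨t, rfl⟩
    linarith [hV0 t ω]
  refine ⟨⟨_, (hVc.sub hcs.hasSum.tendsto_sum_nat).congr fun t => ?_⟩, hcs⟩
  ring

/-- The **Robbins–Siegmund theorem** with deterministic multiplicative perturbations. -/
theorem ae_tendsto_and_summable_of_setLIntegral_mul_le {Ω : Type*} {mΩ : MeasurableSpace Ω}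
    {μ : Measure Ω} [IsFiniteMeasure μ] {ℱ : Filtration ℕ mΩ} {V b c : ℕ → Ω → ℝ} {a : ℕ → ℝ}
    (ha0 : ∀ t, 0 ≤ a t) (ha : Summable a)
    (hV : StronglyAdapted ℱ V) (hb : StronglyAdapted ℱ b) (hc : StronglyAdapted ℱ c)
    (hV0 : ∀ t ω, 0 ≤ V t ω) (hb0 : ∀ t ω, 0 ≤ b t ω) (hc0 : ∀ t ω, 0 ≤ c t ω)
    (hstep : ∀ t, ∀ A, MeasurableSet[ℱ t] A →
      ∫⁻ ω in A, ENNReal.ofReal (V (t + 1) ω) + ENNReal.ofReal (c t ω) ∂μ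
        ≤ ∫⁻ ω in A, ENNReal.ofReal ((1 + a t) * V t ω + b t ω) ∂μ)
    (hbs : ∀ᵐ ω ∂μ, Summable fun t => b t ω) :
    ∀ᵐ ω ∂μ, (∃ l, Tendsto (fun t => V t ω) atTop (𝓝 l)) ∧ Summable fun t => c t ω := by
  -- Discounting by `exp (-S t)` absorbs the factors `1 + a t ≤ exp (a t)`; as `S` is bounded, the
  -- discount can be undone in the limit.
  set S : ℕ → ℝ := fun t => ∑ i ∈ Finset.range t, a i with hS
  have hS0 : ∀ t, 0 ≤ S t := fun t => Finset.sum_nonneg fun i _ => ha0 i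
  have hSle : ∀ t, S t ≤ ∑' i, a i := fun t => ha.sum_le_tsum _ fun i _ => ha0 i
  have main := ae_tendsto_and_summable_of_setLIntegral_le (μ := μ) (ℱ := ℱ)
    (V := fun t ω => Real.exp (-S t) * V t ω) (b := b)
    (c := fun t ω => Real.exp (-S (t + 1)) * c t ω)
    (fun t => (hV t).const_mul _) hb (fun t => (hc t).const_mul _)
    (fun t ω => mul_nonneg (Real.exp_pos _).le (hV0 t ω)) hb0
    (fun t ω => mul_nonneg (Real.exp_pos _).le (hc0 t ω)) ?_ hbs
  · filter_upwards [main] with ω ⟨⟨l, hl⟩, hcs⟩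
    refine ⟨⟨Real.exp (∑' i, a i) * l, ?_⟩, ?_⟩
    · refine ((Real.continuous_exp.tendsto _).comp ha.hasSum.tendsto_sum_nat |>.mul hl).congr
        fun t => ?_
      simp only [Function.comp_apply]
      rw [← mul_assoc, ← Real.exp_add]
      simp [hS]
    · refine Summable.of_nonneg_of_le (hc0 · ω) (fun t => ?_) (hcs.mul_left (Real.exp (∑' i, a i)))
      rw [← mul_assoc, ← Real.exp_add]
      refine le_mul_of_one_le_left (hc0 t ω) (Real.one_le_exp ?_)
      linarith [hSle (t + 1)]
  · intro t A hA
    calc ∫⁻ ω in A, ENNReal.ofReal (Real.exp (-S (t + 1)) * V (t + 1) ω)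
            + ENNReal.ofReal (Real.exp (-S (t + 1)) * c t ω) ∂μ
        = ENNReal.ofReal (Real.exp (-S (t + 1))) *
            ∫⁻ ω in A, ENNReal.ofReal (V (t + 1) ω) + ENNReal.ofReal (c t ω) ∂μ := by
          rw [← lintegral_const_mul' _ _ ENNReal.ofReal_ne_top]
          simp_rw [mul_add, ENNReal.ofReal_mul (Real.exp_pos _).le]
      _ ≤ ENNReal.ofReal (Real.exp (-S (t + 1))) *
            ∫⁻ ω in A, ENNReal.ofReal ((1 + a t) * V t ω + b t ω) ∂μ := by
          exact mul_le_mul' le_rfl (hstep t A hA)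
      _ = ∫⁻ ω in A, ENNReal.ofReal
            (Real.exp (-S (t + 1)) * ((1 + a t) * V t ω + b t ω)) ∂μ := by
          rw [← lintegral_const_mul' _ _ ENNReal.ofReal_ne_top]
          simp_rw [ENNReal.ofReal_mul (Real.exp_pos (-S (t + 1))).le]
      _ ≤ _ := by
          refine lintegral_mono fun ω => ENNReal.ofReal_le_ofReal ?_
          have h1 : Real.exp (-S (t + 1)) * (1 + a t) ≤ Real.exp (-S t) := by
            have : -S t = -S (t + 1) + a t := by simp [hS, Finset.sum_range_succ]
            rw [this, Real.exp_add]
            gcongr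
            linarith [Real.add_one_le_exp (a t)]
          have h2 : Real.exp (-S (t + 1)) ≤ 1 := Real.exp_le_one_iff.2 (by linarith [hS0 (t + 1)])
          have h3 := mul_le_mul_of_nonneg_right h1 (hV0 t ω)
          have h4 := mul_le_mul_of_nonneg_right h2 (hb0 t ω)
          linarith

/-! ### Functions with Lipschitz gradient -/

/-- On the ball of radius `‖h‖` about `x` the derivative differs from that at `x` by at most `L *
‖h‖`, so the mean value inequality suffices; the sharper constant `L / 2` is not needed. -/
theorem apply_add_le_of_lipschitz_gradient {E : Type*} [NormedAddCommGroup E]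
    [InnerProductSpace ℝ E] [CompleteSpace E] {f : E → ℝ} {L : ℝ} (hL : 0 ≤ L)
    (hf : Differentiable ℝ f) (hlip : ∀ x y, ‖gradient f x - gradient f y‖ ≤ L * ‖x - y‖)
    (x h : E) : f (x + h) ≤ f x + inner ℝ (gradient f x) h + L * ‖h‖ ^ 2 := by
  have hder : ∀ y, HasFDerivAt f (InnerProductSpace.toDual ℝ E (gradient f y)) y := fun y =>
    (hf y).hasGradientAt.hasFDerivAt
  have hbound := (convex_closedBall x ‖h‖).norm_image_sub_le_of_norm_hasFDerivWithin_le'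
    (φ := InnerProductSpace.toDual ℝ E (gradient f x)) (C := L * ‖h‖) (y := x + h)
    (fun y _ => (hder y).hasFDerivWithinAt) (fun y hy => ?_)
    (Metric.mem_closedBall_self (norm_nonneg h)) (by simp)
  · rw [add_sub_cancel_left, InnerProductSpace.toDual_apply_apply] at hbound
    have := (le_abs_self _).trans hbound
    linarith
  · rw [← map_sub, LinearIsometryEquiv.norm_map]
    rw [Metric.mem_closedBall, dist_eq_norm] at hy
    exact (hlip y x).trans (mul_le_mul_of_nonneg_left hy hL)

/-- A gradient step of length `1 / (2 * L)` lowers `f` by at least `‖∇f‖² / (4 * L)`, yet cannot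
make it negative. -/
theorem norm_gradient_sq_le_of_nonneg {E : Type*} [NormedAddCommGroup E]
    [InnerProductSpace ℝ E] [CompleteSpace E] {f : E → ℝ} {L : ℝ} (hL : 0 < L)
    (hf : Differentiable ℝ f) (hlip : ∀ x y, ‖gradient f x - gradient f y‖ ≤ L * ‖x - y‖)
    (hnn : ∀ x, 0 ≤ f x) (x : E) : ‖gradient f x‖ ^ 2 ≤ 4 * L * f x := by
  have h := (hnn _).trans
    (apply_add_le_of_lipschitz_gradient hL.le hf hlip x (-(1 / (2 * L)) • gradient f x))
  rw [inner_smul_right, real_inner_self_eq_norm_sq, norm_smul, mul_pow, Real.norm_eq_abs,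
    sq_abs] at h
  have h2 := mul_nonneg (mul_pos four_pos hL).le h
  have : 4 * L * (f x + -(1 / (2 * L)) * ‖gradient f x‖ ^ 2
      + L * ((-(1 / (2 * L))) ^ 2 * ‖gradient f x‖ ^ 2))
      = 4 * L * f x - ‖gradient f x‖ ^ 2 := by
    field_simp
    ring
  linarith

/-! ### From conditional moments to integrals over past sets -/

/-- An inequality between integrals over sets of a sub-σ-algebra on which `Φ` is bounded extends,
for nonnegative functions, to all sets of the sub-σ-algebra. -/
theorem setLIntegral_add_le_of_setIntegral_le_of_bounded {Ω : Type*} {m mΩ : MeasurableSpace Ω}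
    {μ : Measure Ω} {Φ X C G : Ω → ℝ} (hΦ : Measurable[m] Φ)
    (hX0 : ∀ ω, 0 ≤ X ω) (hC0 : ∀ ω, 0 ≤ C ω) (hG0 : ∀ ω, 0 ≤ G ω)
    (h : ∀ (M : ℝ) (A : Set Ω), MeasurableSet[m] A → (∀ ω ∈ A, Φ ω ≤ M) →
      IntegrableOn (fun ω => X ω + C ω) A μ ∧ IntegrableOn G A μ ∧
        ∫ ω in A, X ω + C ω ∂μ ≤ ∫ ω in A, G ω ∂μ)
    {A : Set Ω} (hA : MeasurableSet[m] A) :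
    ∫⁻ ω in A, ENNReal.ofReal (X ω) + ENNReal.ofReal (C ω) ∂μ
      ≤ ∫⁻ ω in A, ENNReal.ofReal (G ω) ∂μ := by
  -- These sets increase to `A`, so monotone convergence removes the truncation.
  set B : ℕ → Set Ω := fun M => A ∩ {ω | Φ ω ≤ M} with hB
  have hBU : A = ⋃ M, B M := by
    ext ω
    simp only [hB, Set.mem_iUnion, Set.mem_inter_iff, Set.mem_ofPred_eq, exists_and_left]
    exact ⟨fun h => ⟨h, exists_nat_ge _⟩, fun h => h.1⟩
  have hBmono : Monotone B := fun i j hij ω hω =>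
    ⟨hω.1, le_trans (show Φ ω ≤ i from hω.2) (Nat.cast_le.2 hij)⟩
  rw [hBU, setLIntegral_iUnion_of_directed _ hBmono.directed_le,
    setLIntegral_iUnion_of_directed _ hBmono.directed_le]
  refine iSup_mono fun M => ?_
  obtain ⟨h1, h2, h3⟩ := h M (B M) (hA.inter (measurableSet_le hΦ measurable_const))
    fun ω hω => hω.2
  simp_rw [← ENNReal.ofReal_add (hX0 _) (hC0 _)]
  rw [← ofReal_integral_eq_lintegral_ofReal h1
      (ae_of_all _ fun ω => add_nonneg (hX0 ω) (hC0 ω)),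
    ← ofReal_integral_eq_lintegral_ofReal h2 (ae_of_all _ hG0)]
  exact ENNReal.ofReal_le_ofReal h3

theorem integrableOn_and_setIntegral_norm_sq_le_of_condLExp_le {Ω E : Type*}
    [NormedAddCommGroup E] {m mΩ : MeasurableSpace Ω} {μ : Measure Ω} [IsFiniteMeasure μ]
    (hm : m ≤ mΩ) {s : Ω → E} (hs : AEStronglyMeasurable s μ) {Z : Ω → ℝ} (hZ0 : ∀ ω, 0 ≤ Z ω)
    (h : ∀ᵐ ω ∂μ, (μ⁻[fun ω' => ‖s ω'‖ₑ ^ 2 | m]) ω ≤ ENNReal.ofReal (Z ω))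
    {A : Set Ω} (hA : MeasurableSet[m] A) (hZ : IntegrableOn Z A μ) :
    IntegrableOn (fun ω => ‖s ω‖ ^ 2) A μ ∧ ∫ ω in A, ‖s ω‖ ^ 2 ∂μ ≤ ∫ ω in A, Z ω ∂μ := by
  have hle : ∫⁻ ω in A, ENNReal.ofReal (‖s ω‖ ^ 2) ∂μ ≤ ENNReal.ofReal (∫ ω in A, Z ω ∂μ) := by
    rw [ofReal_integral_eq_lintegral_ofReal hZ (ae_of_all _ hZ0)]
    calc ∫⁻ ω in A, ENNReal.ofReal (‖s ω‖ ^ 2) ∂μ = ∫⁻ ω in A, ‖s ω‖ₑ ^ 2 ∂μ := by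
          simp_rw [ENNReal.ofReal_pow (norm_nonneg _), ofReal_norm]
      _ = ∫⁻ ω in A, (μ⁻[fun ω' => ‖s ω'‖ₑ ^ 2 | m]) ω ∂μ :=
          (setLIntegral_condLExp hm μ _ hA).symm
      _ ≤ _ := lintegral_mono_ae (ae_restrict_of_ae h)
  have hsm : AEStronglyMeasurable (fun ω => ‖s ω‖ ^ 2) (μ.restrict A) := (hs.norm.pow 2).restrict
  have hnn : 0 ≤ᵐ[μ.restrict A] fun ω => ‖s ω‖ ^ 2 := ae_of_all _ fun ω => sq_nonneg _
  have hint : IntegrableOn (fun ω => ‖s ω‖ ^ 2) A μ :=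
    (lintegral_ofReal_ne_top_iff_integrable hsm hnn).1
      (ne_top_of_le_ne_top ENNReal.ofReal_ne_top hle)
  refine ⟨hint, ?_⟩
  rw [← ofReal_integral_eq_lintegral_ofReal hint hnn] at hle
  exact (ENNReal.ofReal_le_ofReal_iff (integral_nonneg hZ0)).1 hle

/-- Replacing `g` by `A.indicator g`, bounded and still `m`-measurable, makes the inner product
integrable, so the known factor can be pulled out of the conditional expectation. -/
theorem integrableOn_inner_and_setIntegral_inner_eq {Ω E : Type*} [NormedAddCommGroup E]
    [InnerProductSpace ℝ E] [CompleteSpace E] {m mΩ : MeasurableSpace Ω} {μ : Measure Ω}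
    [IsFiniteMeasure μ] (hm : m ≤ mΩ) {g s : Ω → E} (hg : StronglyMeasurable[m] g)
    (hs : Integrable s μ) {A : Set Ω} (hA : MeasurableSet[m] A) {M : ℝ}
    (hM : ∀ ω ∈ A, ‖g ω‖ ≤ M) :
    IntegrableOn (fun ω => inner ℝ (g ω) (s ω)) A μ ∧
      IntegrableOn (fun ω => inner ℝ (g ω) ((μ[s | m]) ω)) A μ ∧
      ∫ ω in A, inner ℝ (g ω) (s ω) ∂μ = ∫ ω in A, inner ℝ (g ω) ((μ[s | m]) ω) ∂μ := by
  have hbdd : ∀ u : Ω → E, Integrable u μ →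
      Integrable (fun ω => inner ℝ (A.indicator g ω) (u ω)) μ := by
    intro u hu
    refine (hu.norm.const_mul |M|).mono'
      (((hg.indicator hA).mono hm).aestronglyMeasurable.inner hu.1) (ae_of_all _ fun ω => ?_)
    refine (norm_inner_le_norm _ _).trans (mul_le_mul_of_nonneg_right ?_ (norm_nonneg _))
    by_cases hω : ω ∈ A
    · rw [Set.indicator_of_mem hω]
      exact (hM ω hω).trans (le_abs_self M)
    · simp [hω]
  have hcongr : ∀ u : Ω → E, Set.EqOn (fun ω => inner ℝ (A.indicator g ω) (u ω))
      (fun ω => inner ℝ (g ω) (u ω)) A := fun u ω hω => by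
    simp [hω]
  have hpull : μ[fun ω => inner ℝ (A.indicator g ω) (s ω) | m] =ᵐ[μ]
      fun ω => inner ℝ (A.indicator g ω) ((μ[s | m]) ω) :=
    condExp_bilin_of_stronglyMeasurable_left (innerSL ℝ) (hg.indicator hA) (hbdd s hs) hs
  refine ⟨(hbdd s hs).integrableOn.congr_fun (hcongr s) (hm A hA),
    (hbdd _ integrable_condExp).integrableOn.congr_fun (hcongr _) (hm A hA), ?_⟩
  rw [← setIntegral_congr_fun (hm A hA) (hcongr s),
    ← setIntegral_congr_fun (hm A hA) (hcongr (μ[s | m])),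
    ← setIntegral_condExp hm (hbdd s hs) hA]
  exact integral_congr_ae (ae_restrict_of_ae hpull)

theorem continuous_of_norm_sub_le_mul {E F : Type*} [NormedAddCommGroup E] [NormedAddCommGroup F]
    {g : E → F} {L : ℝ} (hlip : ∀ x y, ‖g x - g y‖ ≤ L * ‖x - y‖) : Continuous g :=
  (LipschitzWith.of_dist_le_mul (K := L.toNNReal) fun x y => by
    rw [dist_eq_norm, dist_eq_norm]
    exact (hlip x y).trans
      (mul_le_mul_of_nonneg_right (Real.le_coe_toNNReal L) (norm_nonneg _))).continuous

/-! ### One-step estimates -/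

section Step

variable {Ω E : Type*} [NormedAddCommGroup E] [InnerProductSpace ℝ E] [CompleteSpace E]
  {m mΩ : MeasurableSpace Ω} {μ : Measure Ω} [IsFiniteMeasure μ]

/-- One step of a gradient method with errors: expected decrease of the objective. -/
theorem setLIntegral_objective_step_le (hm : m ≤ mΩ) {f : E → ℝ} {L : ℝ} (hL : 0 < L)
    (hf : Differentiable ℝ f) (hlip : ∀ x y, ‖gradient f x - gradient f y‖ ≤ L * ‖x - y‖)
    (hnn : ∀ x, 0 ≤ f x) {r r' s w : Ω → E} (hr : StronglyMeasurable[m] r)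
    (hr' : AEStronglyMeasurable r' μ) (hs : Integrable s μ) (hw : AEStronglyMeasurable w μ)
    {γ c₁ c₂ δ ε : ℝ} (hγ : 0 ≤ γ) (hc₁ : 0 ≤ c₁) (hc₂ : 0 ≤ c₂) (hδ : 0 ≤ δ) (hε : 0 ≤ ε)
    (hrec : ∀ᵐ ω ∂μ, r' ω = r ω + γ • (s ω + w ω))
    (hdesc : ∀ᵐ ω ∂μ,
      c₁ * ‖gradient f (r ω)‖ ^ 2 ≤ -(inner ℝ (gradient f (r ω)) ((μ[s | m]) ω)))
    (hs2 : ∀ᵐ ω ∂μ, (μ⁻[fun ω' => ‖s ω'‖ₑ ^ 2 | m]) ω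
      ≤ ENNReal.ofReal (c₂ * ‖gradient f (r ω)‖ ^ 2))
    (hw2 : ∀ᵐ ω ∂μ, (μ⁻[fun ω' => ‖w ω'‖ₑ ^ 2 | m]) ω
      ≤ ENNReal.ofReal (δ + ε * ‖gradient f (r ω)‖ ^ 2))
    {A : Set Ω} (hA : MeasurableSet[m] A) :
    ∫⁻ ω in A, ENNReal.ofReal (f (r' ω)) + ENNReal.ofReal (c₁ * γ * ‖gradient f (r ω)‖ ^ 2) ∂μ
      ≤ ∫⁻ ω in A, ENNReal.ofReal (f (r ω)
          + (1 / 2 + 2 * L * c₂) * γ ^ 2 * ‖gradient f (r ω)‖ ^ 2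
          + (1 / 2 + 2 * L * γ ^ 2) * (δ + ε * ‖gradient f (r ω)‖ ^ 2)) ∂μ := by
  have hfr : StronglyMeasurable[m] fun ω => f (r ω) := hf.continuous.comp_stronglyMeasurable hr
  have hgr : StronglyMeasurable[m] fun ω => gradient f (r ω) :=
    (continuous_of_norm_sub_le_mul hlip).comp_stronglyMeasurable hr
  -- Bounding `f (r ω)` also bounds the gradient there, which makes every term below integrable.
  refine setLIntegral_add_le_of_setIntegral_le_of_bounded (m := m) (Φ := fun ω => f (r ω))
    hfr.measurable (fun ω => hnn _) (fun ω => by positivity)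
    (fun ω => by have := hnn (r ω); positivity) (fun M A hA hM => ?_) hA
  have hN : ∀ ω ∈ A, ‖gradient f (r ω)‖ ^ 2 ≤ 4 * L * M := fun ω hω =>
    (norm_gradient_sq_le_of_nonneg hL hf hlip hnn _).trans
      (mul_le_mul_of_nonneg_left (hM ω hω) (by positivity))
  have hFi : IntegrableOn (fun ω => f (r ω)) A μ :=
    Measure.integrableOn_of_bounded (M := M) (measure_ne_top _ _)
      (hfr.mono hm).aestronglyMeasurable
      ((ae_restrict_iff' (hm A hA)).2 (ae_of_all _ fun ω hω => by
        rw [Real.norm_of_nonneg (hnn _)]; exact hM ω hω))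
  have hNi : IntegrableOn (fun ω => ‖gradient f (r ω)‖ ^ 2) A μ :=
    Measure.integrableOn_of_bounded (M := 4 * L * M) (measure_ne_top _ _)
      ((hgr.mono hm).aestronglyMeasurable.norm.pow 2)
      ((ae_restrict_iff' (hm A hA)).2 (ae_of_all _ fun ω hω => by
        rw [Real.norm_of_nonneg (sq_nonneg _)]; exact hN ω hω))
  have hδi : IntegrableOn (fun _ : Ω => δ) A μ := integrable_const _
  have hZi : IntegrableOn (fun ω => δ + ε * ‖gradient f (r ω)‖ ^ 2) A μ :=
    hδi.add (hNi.const_mul _)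
  obtain ⟨hSi, hS⟩ := integrableOn_and_setIntegral_norm_sq_le_of_condLExp_le hm hs.1
    (fun ω => by positivity) hs2 hA (hNi.const_mul c₂)
  obtain ⟨hWi, hW⟩ := integrableOn_and_setIntegral_norm_sq_le_of_condLExp_le hm hw
    (fun ω => by positivity) hw2 hA hZi
  obtain ⟨hIi, hIi', hI⟩ := integrableOn_inner_and_setIntegral_inner_eq hm hgr hs hA
    (M := 4 * L * M + 1) (fun ω hω => by
      nlinarith [hN ω hω, sq_nonneg (‖gradient f (r ω)‖ - 1)])
  have hI2 : ∫ ω in A, inner ℝ (gradient f (r ω)) ((μ[s | m]) ω) ∂μ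
      ≤ ∫ ω in A, -c₁ * ‖gradient f (r ω)‖ ^ 2 ∂μ := by
    refine integral_mono_ae hIi' (hNi.const_mul _) (ae_restrict_of_ae ?_)
    filter_upwards [hdesc] with ω hω
    linarith
  rw [integral_const_mul] at hS hI2
  -- Young's inequality pairs `γ ‖∇f‖` with `‖w‖`: the coefficient `1 / 2` of `‖w‖²` carries no `γ`,
  -- which is harmless when `‖w‖²` is itself of conditional order `γ²`.
  have hle : ∀ᵐ ω ∂μ.restrict A, f (r' ω) ≤ f (r ω) + γ * inner ℝ (gradient f (r ω)) (s ω)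
      + 1 / 2 * γ ^ 2 * ‖gradient f (r ω)‖ ^ 2 + 2 * L * γ ^ 2 * ‖s ω‖ ^ 2
      + (1 / 2 + 2 * L * γ ^ 2) * ‖w ω‖ ^ 2 := by
    filter_upwards [ae_restrict_of_ae hrec] with ω hω
    have h1 := apply_add_le_of_lipschitz_gradient hL.le hf hlip (r ω) (γ • (s ω + w ω))
    rw [← hω, inner_smul_right, inner_add_right, norm_smul, mul_pow, Real.norm_eq_abs,
      sq_abs] at h1
    have h2 := real_inner_le_norm (gradient f (r ω)) (w ω)
    have h3 : ‖s ω + w ω‖ ^ 2 ≤ 2 * (‖s ω‖ ^ 2 + ‖w ω‖ ^ 2) :=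
      (pow_le_pow_left₀ (norm_nonneg _) (norm_add_le _ _) 2).trans
        (by nlinarith [sq_nonneg (‖s ω‖ - ‖w ω‖)])
    have h4 := mul_le_mul_of_nonneg_left h3 (by positivity : 0 ≤ L * γ ^ 2)
    have h5 := mul_le_mul_of_nonneg_left h2 hγ
    nlinarith [sq_nonneg (γ * ‖gradient f (r ω)‖ - ‖w ω‖)]
  have hU1 := hFi.add (hIi.const_mul γ)
  have hU2 := hU1.add (hNi.const_mul (1 / 2 * γ ^ 2))
  have hU3 := hU2.add (hSi.const_mul (2 * L * γ ^ 2))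
  have hUi := hU3.add (hWi.const_mul (1 / 2 + 2 * L * γ ^ 2))
  have hXi : IntegrableOn (fun ω => f (r' ω)) A μ := by
    refine Integrable.mono' hUi (hf.continuous.comp_aestronglyMeasurable hr').restrict ?_
    filter_upwards [hle] with ω hω
    rw [Real.norm_of_nonneg (hnn _)]
    exact hω
  have hG1 := hFi.add (hNi.const_mul ((1 / 2 + 2 * L * c₂) * γ ^ 2))
  have hG := hG1.add (hZi.const_mul (1 / 2 + 2 * L * γ ^ 2))
  refine ⟨hXi.add (hNi.const_mul _), hG, ?_⟩
  have hXU := integral_mono_ae hXi hUi hle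
  have eX := integral_add hXi (hNi.const_mul (c₁ * γ))
  have e1 := integral_add hU3 (hWi.const_mul (1 / 2 + 2 * L * γ ^ 2))
  have e2 := integral_add hU2 (hSi.const_mul (2 * L * γ ^ 2))
  have e3 := integral_add hU1 (hNi.const_mul (1 / 2 * γ ^ 2))
  have e4 := integral_add hFi (hIi.const_mul γ)
  have e5 := integral_add hG1 (hZi.const_mul (1 / 2 + 2 * L * γ ^ 2))
  have e6 := integral_add hFi (hNi.const_mul ((1 / 2 + 2 * L * c₂) * γ ^ 2))
  simp only [Pi.add_apply, integral_const_mul] at eX e1 e2 e3 e4 e5 e6 hXU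
  rw [eX, e5, e6]
  rw [e1, e2, e3, e4] at hXU
  have k1 := mul_le_mul_of_nonneg_left (hI.le.trans hI2) hγ
  have k2 := mul_le_mul_of_nonneg_left hS (by positivity : 0 ≤ 2 * L * γ ^ 2)
  have k3 := mul_le_mul_of_nonneg_left hW (by positivity : 0 ≤ 1 / 2 + 2 * L * γ ^ 2)
  linarith

/-- One step of a gradient method with errors: expected growth of the squared gradient norm. -/
theorem setLIntegral_norm_gradient_sq_step_le (hm : m ≤ mΩ) {f : E → ℝ} {L : ℝ} (hL : 0 ≤ L)
    (hlip : ∀ x y, ‖gradient f x - gradient f y‖ ≤ L * ‖x - y‖)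
    {r r' s w : Ω → E} (hr : StronglyMeasurable[m] r)
    (hr' : AEStronglyMeasurable r' μ) (hs : AEStronglyMeasurable s μ)
    (hw : AEStronglyMeasurable w μ)
    {γ c₂ δ ε : ℝ} (hγ : 0 ≤ γ) (hc₂ : 0 ≤ c₂) (hδ : 0 ≤ δ) (hε : 0 ≤ ε)
    (hrec : ∀ᵐ ω ∂μ, r' ω = r ω + γ • (s ω + w ω))
    (hs2 : ∀ᵐ ω ∂μ, (μ⁻[fun ω' => ‖s ω'‖ₑ ^ 2 | m]) ω
      ≤ ENNReal.ofReal (c₂ * ‖gradient f (r ω)‖ ^ 2))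
    (hw2 : ∀ᵐ ω ∂μ, (μ⁻[fun ω' => ‖w ω'‖ₑ ^ 2 | m]) ω
      ≤ ENNReal.ofReal (δ + ε * ‖gradient f (r ω)‖ ^ 2))
    {A : Set Ω} (hA : MeasurableSet[m] A) :
    ∫⁻ ω in A, ENNReal.ofReal (‖gradient f (r' ω)‖ ^ 2) + ENNReal.ofReal 0 ∂μ
      ≤ ∫⁻ ω in A, ENNReal.ofReal (
          (1 + L * γ + L * γ ^ 2 + (L * γ + 2 * L ^ 2 * γ ^ 2) * c₂) * ‖gradient f (r ω)‖ ^ 2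
          + (L + 2 * L ^ 2 * γ ^ 2) * (δ + ε * ‖gradient f (r ω)‖ ^ 2)) ∂μ := by
  have hgc : Continuous (gradient f) := continuous_of_norm_sub_le_mul hlip
  have hgr : StronglyMeasurable[m] fun ω => ‖gradient f (r ω)‖ ^ 2 :=
    (hgc.norm.pow 2).comp_stronglyMeasurable hr
  refine setLIntegral_add_le_of_setIntegral_le_of_bounded (m := m)
    (Φ := fun ω => ‖gradient f (r ω)‖ ^ 2) (C := fun _ => 0)
    hgr.measurable (fun ω => sq_nonneg _) (fun ω => le_rfl)
    (fun ω => by positivity) (fun M A hA hM => ?_) hA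
  have hNi : IntegrableOn (fun ω => ‖gradient f (r ω)‖ ^ 2) A μ :=
    Measure.integrableOn_of_bounded (M := M) (measure_ne_top _ _)
      (hgr.mono hm).aestronglyMeasurable
      ((ae_restrict_iff' (hm A hA)).2 (ae_of_all _ fun ω hω => by
        rw [Real.norm_of_nonneg (sq_nonneg _)]; exact hM ω hω))
  have hδi : IntegrableOn (fun _ : Ω => δ) A μ := integrable_const _
  have hZi : IntegrableOn (fun ω => δ + ε * ‖gradient f (r ω)‖ ^ 2) A μ :=
    hδi.add (hNi.const_mul _)
  obtain ⟨hSi, hS⟩ := integrableOn_and_setIntegral_norm_sq_le_of_condLExp_le hm hs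
    (fun ω => by positivity) hs2 hA (hNi.const_mul c₂)
  obtain ⟨hWi, hW⟩ := integrableOn_and_setIntegral_norm_sq_le_of_condLExp_le hm hw
    (fun ω => by positivity) hw2 hA hZi
  rw [integral_const_mul] at hS
  -- The cross term with `s` is split evenly and stays of order `γ`; in the one with `w`, all of `γ`
  -- goes to the gradient, giving `γ² ‖∇f‖² + ‖w‖²`.
  have hle : ∀ᵐ ω ∂μ.restrict A, ‖gradient f (r' ω)‖ ^ 2
      ≤ (1 + L * γ + L * γ ^ 2) * ‖gradient f (r ω)‖ ^ 2
      + (L * γ + 2 * L ^ 2 * γ ^ 2) * ‖s ω‖ ^ 2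
      + (L + 2 * L ^ 2 * γ ^ 2) * ‖w ω‖ ^ 2 := by
    filter_upwards [ae_restrict_of_ae hrec] with ω hω
    have h1 : ‖gradient f (r' ω)‖ ≤ ‖gradient f (r ω)‖ + L * γ * (‖s ω‖ + ‖w ω‖) := by
      have h2 := hlip (r' ω) (r ω)
      have h3 := norm_sub_norm_le (gradient f (r' ω)) (gradient f (r ω))
      rw [hω, add_sub_cancel_left, norm_smul, Real.norm_of_nonneg hγ, ← hω, ← mul_assoc] at h2
      have h4 := mul_le_mul_of_nonneg_left (norm_add_le (s ω) (w ω))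
        (by positivity : 0 ≤ L * γ)
      linarith
    have h2 := pow_le_pow_left₀ (norm_nonneg _) h1 2
    have k1 := mul_nonneg (by positivity : 0 ≤ L * γ)
      (sq_nonneg (‖gradient f (r ω)‖ - ‖s ω‖))
    have k2 := mul_nonneg hL (sq_nonneg (γ * ‖gradient f (r ω)‖ - ‖w ω‖))
    have k3 := mul_nonneg (by positivity : 0 ≤ L ^ 2 * γ ^ 2) (sq_nonneg (‖s ω‖ - ‖w ω‖))
    linarith
  have hU1 := (hNi.const_mul (1 + L * γ + L * γ ^ 2)).add
    (hSi.const_mul (L * γ + 2 * L ^ 2 * γ ^ 2))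
  have hUi := hU1.add (hWi.const_mul (L + 2 * L ^ 2 * γ ^ 2))
  have hXi : IntegrableOn (fun ω => ‖gradient f (r' ω)‖ ^ 2) A μ := by
    refine Integrable.mono' hUi ((hgc.norm.pow 2).comp_aestronglyMeasurable hr').restrict ?_
    filter_upwards [hle] with ω hω
    rw [Real.norm_of_nonneg (sq_nonneg _)]
    exact hω
  have hG1 := hNi.const_mul (1 + L * γ + L * γ ^ 2 + (L * γ + 2 * L ^ 2 * γ ^ 2) * c₂)
  have hG2 := hZi.const_mul (L + 2 * L ^ 2 * γ ^ 2)
  simp only [add_zero]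
  refine ⟨hXi, hG1.add hG2, ?_⟩
  have hXU := integral_mono_ae hXi hUi hle
  have e1 := integral_add hU1 (hWi.const_mul (L + 2 * L ^ 2 * γ ^ 2))
  have e2 := integral_add (hNi.const_mul (1 + L * γ + L * γ ^ 2))
    (hSi.const_mul (L * γ + 2 * L ^ 2 * γ ^ 2))
  have e3 := integral_add hG1 hG2
  simp only [Pi.add_apply, integral_const_mul] at e1 e2 e3 hXU
  rw [e3]
  rw [e1, e2] at hXU
  have k2 := mul_le_mul_of_nonneg_left hS (by positivity : 0 ≤ L * γ + 2 * L ^ 2 * γ ^ 2)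
  have k3 := mul_le_mul_of_nonneg_left hW (by positivity : 0 ≤ L + 2 * L ^ 2 * γ ^ 2)
  linarith

end Step

/-! ### Conclusion -/

/-- If `l > 0`, eventually `N t > l / 2`, so `γ t` is dominated by the summable `(2 / l) * (γ t * N
t)`. -/
theorem eq_zero_of_tendsto_of_summable_mul {γ N : ℕ → ℝ} (hγ : ∀ t, 0 ≤ γ t)
    (hN : ∀ t, 0 ≤ N t) (hsum : Tendsto (fun k => ∑ t ∈ Finset.range k, γ t) atTop atTop)
    (hγN : Summable fun t => γ t * N t) {l : ℝ} (hl : Tendsto N atTop (𝓝 l)) : l = 0 := by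
  by_contra hne
  have hl0 : 0 < l := lt_of_le_of_ne (ge_of_tendsto' hl hN) (Ne.symm hne)
  refine (not_summable_iff_tendsto_nat_atTop_of_nonneg hγ).2 hsum ?_
  refine Summable.of_norm_bounded_eventually_nat (hγN.mul_left (2 / l)) ?_
  filter_upwards [hl.eventually (lt_mem_nhds (half_lt_self hl0))] with t ht
  rw [Real.norm_of_nonneg (hγ t)]
  have h1 : 1 ≤ 2 / l * N t := by
    rw [div_mul_eq_mul_div, le_div_iff₀ hl0]
    linarith
  calc γ t ≤ γ t * (2 / l * N t) := le_mul_of_one_le_right (hγ t) h1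
    _ = 2 / l * (γ t * N t) := by ring

theorem mainTheorem3
    {Ω : Type*} {mΩ : MeasurableSpace Ω} (μ : Measure Ω) [IsProbabilityMeasure μ]
    (ℱ : Filtration ℕ mΩ) (n : ℕ)
    -- the objective function
    (f : EuclideanSpace ℝ (Fin n) → ℝ) (L : ℝ)
    (hf_nonneg : ∀ x, 0 ≤ f x)
    (hf_C1 : ContDiff ℝ 1 f)
    (hf_lip : ∀ x y, ‖gradient f x - gradient f y‖ ≤ L * ‖x - y‖)
    -- the deterministic stepsizes
    (γ : ℕ → ℝ) (hγ_nonneg : ∀ t, 0 ≤ γ t)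
    (hγ_sum : Tendsto (fun N => ∑ t ∈ Finset.range N, γ t) atTop atTop)
    (hγ_sq : Summable (fun t => γ t ^ 2))
    -- the iterates, adapted to the history, and the two parts of the step direction
    (r s w : ℕ → Ω → EuclideanSpace ℝ (Fin n))
    (hr_adapted : StronglyAdapted ℱ r)
    (hs_int : ∀ t, Integrable (s t) μ)
    (hw_meas : ∀ t, AEStronglyMeasurable (w t) μ)
    (h_rec : ∀ t, ∀ᵐ ω ∂μ, r (t + 1) ω = r t ω + γ t • (s t ω + w t ω))
    -- the conditions on the step directions, conditionally on the history; second moments are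
    -- conditional expectations of nonnegative extended-real-valued variables
    (c₁ c₂ p q : ℝ) (hc₁ : 0 < c₁) (hc₂ : 0 < c₂) (hp : 0 < p) (hq : 0 < q)
    (hs_descent : ∀ t, ∀ᵐ ω ∂μ,
      c₁ * ‖gradient f (r t ω)‖ ^ 2 ≤ -(inner ℝ (gradient f (r t ω)) ((μ[s t | ℱ t]) ω)))
    (hs_sq : ∀ t, ∀ᵐ ω ∂μ,
      (μ⁻[fun ω' => ‖s t ω'‖ₑ ^ 2 | ℱ t]) ω
        ≤ ENNReal.ofReal (c₂ * ‖gradient f (r t ω)‖ ^ 2))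
    (hw_sq : ∀ t, ∀ᵐ ω ∂μ,
      (μ⁻[fun ω' => ‖w t ω'‖ₑ ^ 2 | ℱ t]) ω
        ≤ ENNReal.ofReal ((γ t * (q + p * ‖gradient f (r t ω)‖)) ^ 2)) :
    ∀ᵐ ω ∂μ,
      (∃ l : ℝ, Tendsto (fun t => f (r t ω)) atTop (𝓝 l)) ∧
      Tendsto (fun t => gradient f (r t ω)) atTop (𝓝 0) ∧
      ∀ x, MapClusterPt x atTop (fun t => r t ω) → gradient f x = 0 := by
  -- `L` may be zero or negative, while the bound on `‖∇f‖²` by `f` divides by the constant.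
  obtain ⟨K, hK, hlip⟩ : ∃ K : ℝ, 0 < K ∧ ∀ x y, ‖gradient f x - gradient f y‖ ≤ K * ‖x - y‖ :=
    ⟨max L 1, by positivity, fun x y => (hf_lip x y).trans
      (mul_le_mul_of_nonneg_right (le_max_left _ _) (norm_nonneg _))⟩
  have hfd : Differentiable ℝ f := hf_C1.differentiable one_ne_zero
  have hgc : Continuous (gradient f) := continuous_of_norm_sub_le_mul hlip
  have hNm : StronglyAdapted ℱ fun t ω => ‖gradient f (r t ω)‖ ^ 2 := fun t =>
    (hgc.norm.pow 2).comp_stronglyMeasurable (hr_adapted t)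
  have hrm : ∀ t, AEStronglyMeasurable (r t) μ := fun t =>
    ((hr_adapted t).mono (ℱ.le t)).aestronglyMeasurable
  have hw2 : ∀ t, ∀ᵐ ω ∂μ, (μ⁻[fun ω' => ‖w t ω'‖ₑ ^ 2 | ℱ t]) ω
      ≤ ENNReal.ofReal (2 * γ t ^ 2 * q ^ 2 + 2 * γ t ^ 2 * p ^ 2 * ‖gradient f (r t ω)‖ ^ 2) := by
    intro t
    filter_upwards [hw_sq t] with ω hω
    refine hω.trans (ENNReal.ofReal_le_ofReal ?_)
    have := mul_nonneg (sq_nonneg (γ t)) (sq_nonneg (q - p * ‖gradient f (r t ω)‖))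
    linarith
  set Γ : ℝ := ∑' t, γ t ^ 2 with hΓ
  have hγΓ : ∀ t, γ t ^ 2 ≤ Γ := fun t => hγ_sq.le_tsum t fun i _ => sq_nonneg _
  have hΓ0 : 0 ≤ Γ := tsum_nonneg fun t => sq_nonneg _
  have hobj : ∀ᵐ ω ∂μ, (∃ l, Tendsto (fun t => f (r t ω)) atTop (𝓝 l)) ∧
      Summable fun t => c₁ * γ t * ‖gradient f (r t ω)‖ ^ 2 := by
    refine ae_tendsto_and_summable_of_setLIntegral_mul_le (ℱ := ℱ)
      (V := fun t ω => f (r t ω))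
      (c := fun t ω => c₁ * γ t * ‖gradient f (r t ω)‖ ^ 2)
      (b := fun t _ => 2 * (1 / 2 + 2 * K * Γ) * q ^ 2 * γ t ^ 2)
      -- The factor `4 * K` comes from trading `‖∇f‖²` for `f`; `Γ` bounds the stray `γ t ^ 2`
      -- inside the coefficients.
      (a := fun t => ((1 / 2 + 2 * K * c₂) + 2 * (1 / 2 + 2 * K * Γ) * p ^ 2) * (4 * K) * γ t ^ 2)
      (fun t => by positivity) (hγ_sq.mul_left _)
      (fun t => hfd.continuous.comp_stronglyMeasurable (hr_adapted t))
      (fun t => stronglyMeasurable_const) (fun t => (hNm t).const_mul _)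
      (fun t ω => hf_nonneg _) (fun t ω => by positivity)
      (fun t ω => by have := hγ_nonneg t; positivity) (fun t A hA => ?_)
      (ae_of_all _ fun ω => hγ_sq.mul_left _)
    refine (setLIntegral_objective_step_le (ℱ.le t) hK hfd hlip hf_nonneg (hr_adapted t)
      (hrm (t + 1)) (hs_int t) (hw_meas t) (hγ_nonneg t) hc₁.le hc₂.le (by positivity)
      (by positivity) (h_rec t) (hs_descent t) (hs_sq t) (hw2 t) hA).trans ?_
    refine lintegral_mono fun ω => ENNReal.ofReal_le_ofReal ?_
    have hN := norm_gradient_sq_le_of_nonneg hK hfd hlip hf_nonneg (r t ω)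
    have h1 : 1 / 2 + 2 * K * γ t ^ 2 ≤ 1 / 2 + 2 * K * Γ := by gcongr; exact hγΓ t
    have h2 := mul_le_mul_of_nonneg_right h1 (by positivity :
      0 ≤ 2 * γ t ^ 2 * q ^ 2 + 2 * γ t ^ 2 * p ^ 2 * ‖gradient f (r t ω)‖ ^ 2)
    have h3 := mul_le_mul_of_nonneg_left hN (by positivity :
      0 ≤ ((1 / 2 + 2 * K * c₂) + 2 * (1 / 2 + 2 * K * Γ) * p ^ 2) * γ t ^ 2)
    linarith
  have hγN : ∀ᵐ ω ∂μ, Summable fun t => γ t * ‖gradient f (r t ω)‖ ^ 2 := by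
    filter_upwards [hobj] with ω hω
    refine (hω.2.mul_left c₁⁻¹).congr fun t => ?_
    field_simp
  have hgrad : ∀ᵐ ω ∂μ, (∃ l, Tendsto (fun t => ‖gradient f (r t ω)‖ ^ 2) atTop (𝓝 l)) ∧
      Summable fun _ : ℕ => (0 : ℝ) := by
    refine ae_tendsto_and_summable_of_setLIntegral_mul_le (ℱ := ℱ)
      (V := fun t ω => ‖gradient f (r t ω)‖ ^ 2) (c := fun _ _ => 0)
      -- The first-order term cannot go into `a`, as `∑ γ` diverges; it is a random perturbation,
      -- almost surely summable by `hγN`.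
      (b := fun t ω => K * (1 + c₂) * (γ t * ‖gradient f (r t ω)‖ ^ 2)
        + 2 * (K + 2 * K ^ 2 * Γ) * q ^ 2 * γ t ^ 2)
      (a := fun t => (K + 2 * K ^ 2 * c₂ + 2 * (K + 2 * K ^ 2 * Γ) * p ^ 2) * γ t ^ 2)
      (fun t => by positivity) (hγ_sq.mul_left _) hNm
      (fun t => (((hNm t).const_mul _).const_mul _).add stronglyMeasurable_const)
      (fun t => stronglyMeasurable_const) (fun t ω => sq_nonneg _)
      (fun t ω => by have := hγ_nonneg t; positivity) (fun t ω => le_rfl) (fun t A hA => ?_) ?_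
    · refine (setLIntegral_norm_gradient_sq_step_le (ℱ.le t) hK.le hlip (hr_adapted t)
        (hrm (t + 1)) (hs_int t).1 (hw_meas t) (hγ_nonneg t) hc₂.le (by positivity)
        (by positivity) (h_rec t) (hs_sq t) (hw2 t) hA).trans ?_
      refine lintegral_mono fun ω => ENNReal.ofReal_le_ofReal ?_
      have h1 : K + 2 * K ^ 2 * γ t ^ 2 ≤ K + 2 * K ^ 2 * Γ := by gcongr; exact hγΓ t
      have h2 := mul_le_mul_of_nonneg_right h1 (by positivity :
        0 ≤ 2 * γ t ^ 2 * q ^ 2 + 2 * γ t ^ 2 * p ^ 2 * ‖gradient f (r t ω)‖ ^ 2)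
      linarith
    · filter_upwards [hγN] with ω hω
      exact (hω.mul_left _).add (hγ_sq.mul_left _)
  filter_upwards [hobj, hγN, hgrad] with ω h1 h2 h3
  obtain ⟨⟨l, hl⟩, -⟩ := h3
  obtain rfl := eq_zero_of_tendsto_of_summable_mul hγ_nonneg (fun t => sq_nonneg _) hγ_sum h2 hl
  have hg0 : Tendsto (fun t => gradient f (r t ω)) atTop (𝓝 0) := by
    rw [tendsto_zero_iff_norm_tendsto_zero]
    simpa using hl.sqrt
  refine ⟨h1.1, hg0, fun x hx => ?_⟩
  have hcl : MapClusterPt (gradient f x) atTop (fun t => gradient f (r t ω)) :=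
    hx.continuousAt_comp hgc.continuousAt
  exact eq_of_nhds_neBot (hcl.clusterPt.mono hg0)
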